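/- A metric space $X$ is \emph{geodesic} if any two of its points are joined by a geodesic segment, i.e. by the image of an isometric map $[a,b]\to X$. A geodesic metric space $X$ is \emph{Rips-hyperbolic} if there is $\delta\ge 0$ such that for every geodesic triangle in $X$ each side is contained in the closed $\delta$-neighbourhood of the union of the other two sides (i.e. every point of the side is at distance at most $\delta$ from some point of the other two). A group $G$ is \emph{hyperbolic} if it has a finite generating set $S$ with $1\notin S$ and $S=S^{-1}$ such that the Cayley graph $\mathrm{Cay}(G,S)$ (vertex set $G$, an edge $\{g,gs\}$ for all $g\in G$, $s\in S$), with its path metric in which every edge is isometric to $[0,1]$, is Rips-hyperbolic. A group is \emph{virtually cyclic} if it has a cyclic subgroup of finite index; in particular every finite group is virtually cyclic. $F_2$ denotes the free group of rank $2$. \textbf{Theorem.} Let $G$ be a hyperbolic group. (1) Let $g_1,g_2\in G$ be elements of infinite order. Then $\langle g_1,g_2\rangle$ is virtually cyclic, or there exists an integer $k>0$ such that $\langle g_1^k,g_2^k\rangle$ is a free group of rank $2$. (2) (Tits alternative for hyperbolic groups) Every subgroup $H$ of $G$ contains a subgroup isomorphic to $F_2$ or is virtually cyclic. -/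

import Mathlib

open scoped NNReal ENNReal

/-! ### The geometric realization of a graph, with every edge a copy of `[0, 1]` -/

/-- The geometric realization of a simple graph, in barycentric coordinates: its points are the
formal convex combinations `(1 - t) u + t v` with `t ∈ [0, 1]`, where `u = v` or `{u, v}` is an
edge. (The case `u = v` gives the vertices, also the isolated ones.) -/
def SimpleGraph.Realization {V : Type*} (Γ : SimpleGraph V) : Type _ :=
  {p : V →₀ ℝ // ∃ u v : V, (u = v ∨ Γ.Adj u v) ∧ ∃ t ∈ Set.Icc (0 : ℝ) 1,
    p = Finsupp.single u (1 - t) + Finsupp.single v t}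

namespace SimpleGraph.Realization

variable {V : Type*} {Γ : SimpleGraph V}

/-- The vertex `v`, as a point of the realization. -/
noncomputable def vertex (Γ : SimpleGraph V) (v : V) : Γ.Realization :=
  ⟨Finsupp.single v 1, v, v, Or.inl rfl, 0, by simp, by simp⟩

/-- The parametrization by `[0, 1]` of the edge from `u` to `v`. -/
noncomputable def edgePoint {u v : V} (h : Γ.Adj u v) (t : Set.Icc (0 : ℝ) 1) : Γ.Realization :=
  ⟨Finsupp.single u (1 - (t : ℝ)) + Finsupp.single v (t : ℝ), u, v, Or.inr h, t, t.2, rfl⟩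

/-- `HasPath x y ℓ`: there is a path from `x` to `y`, a concatenation of finitely many segments
each contained in an edge, whose total length is `ℓ`. -/
inductive HasPath : Γ.Realization → Γ.Realization → ℝ≥0 → Prop
  | refl (x : Γ.Realization) : HasPath x x 0
  | cons {u v : V} (h : Γ.Adj u v) (s t : Set.Icc (0 : ℝ) 1) {z : Γ.Realization} {ℓ : ℝ≥0} :
      HasPath (edgePoint h t) z ℓ → HasPath (edgePoint h s) z (nndist s t + ℓ)

theorem HasPath.trans {x y z : Γ.Realization} {ℓ m : ℝ≥0} (h₁ : HasPath x y ℓ)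
    (h₂ : HasPath y z m) : HasPath x z (ℓ + m) := by
  induction h₁ with
  | refl => simpa using h₂
  | cons h s t _ ih => rw [add_assoc]; exact HasPath.cons h s t (ih h₂)

theorem HasPath.symm {x y : Γ.Realization} {ℓ : ℝ≥0} (h : HasPath x y ℓ) : HasPath y x ℓ := by
  induction h with
  | refl => exact HasPath.refl _
  | cons h s t _ ih =>
    rw [add_comm, nndist_comm]
    simpa using ih.trans (HasPath.cons h t s (HasPath.refl _))

theorem HasPath.abs_apply_sub_le {x y : Γ.Realization} {ℓ : ℝ≥0} (h : HasPath x y ℓ) (w : V) :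
    |x.1 w - y.1 w| ≤ ℓ := by
  induction h with
  | refl => simp
  | @cons u v h s t z ℓ _ ih =>
    have key : |(edgePoint h s).1 w - (edgePoint h t).1 w| ≤ |(s : ℝ) - t| := by
      have huv := h.ne
      by_cases hu : u = w
      · have hv : v ≠ w := fun hv => huv (hu.trans hv.symm)
        simp [edgePoint, hu, hv, abs_sub_comm]
      · by_cases hv : v = w <;> simp [edgePoint, hu, hv]
    rw [NNReal.coe_add, coe_nndist, Subtype.dist_eq, Real.dist_eq]
    exact (abs_sub_le _ ((edgePoint h t).1 w) _).trans (add_le_add key ih)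

/-- The path metric: the distance is the infimum of the lengths of the paths (and it is infinite
between different components). -/
noncomputable instance : EMetricSpace Γ.Realization where
  edist x y := ⨅ (ℓ : ℝ≥0) (_ : HasPath x y ℓ), (ℓ : ℝ≥0∞)
  edist_self x := by
    refine le_antisymm ?_ bot_le
    exact iInf₂_le_of_le 0 (HasPath.refl x) (by simp)
  edist_comm x y := by
    refine le_antisymm ?_ ?_ <;> exact le_iInf₂ fun ℓ h => iInf₂_le ℓ h.symm
  edist_triangle x y z := by
    refine ENNReal.le_of_forall_pos_le_add fun ε hε hfin => ?_
    have hε' : ((ε / 2 : ℝ≥0) : ℝ≥0∞) ≠ 0 := by simpa using hε.ne'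
    obtain ⟨h₁, h₂⟩ := ENNReal.add_lt_top.1 hfin
    have l₁ := ENNReal.lt_add_right h₁.ne hε'
    have l₂ := ENNReal.lt_add_right h₂.ne hε'
    obtain ⟨ℓ, l₁⟩ := iInf_lt_iff.1 l₁
    obtain ⟨p, l₁⟩ := iInf_lt_iff.1 l₁
    obtain ⟨m, l₂⟩ := iInf_lt_iff.1 l₂
    obtain ⟨q, l₂⟩ := iInf_lt_iff.1 l₂
    refine (iInf₂_le (ℓ + m) (p.trans q)).trans ?_
    rw [ENNReal.coe_add]
    refine (add_le_add l₁.le l₂.le).trans (le_of_eq ?_)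
    rw [add_add_add_comm, ← ENNReal.coe_add, add_halves]
  eq_of_edist_eq_zero {x y} h := by
    refine Subtype.ext (Finsupp.ext fun w => sub_eq_zero.1 (abs_nonpos_iff.1 ?_))
    refine le_of_forall_pos_le_add fun ε hε => ?_
    have l : (⨅ (ℓ : ℝ≥0) (_ : HasPath x y ℓ), (ℓ : ℝ≥0∞)) < ENNReal.ofReal ε :=
      h.trans_lt (ENNReal.ofReal_pos.2 hε)
    obtain ⟨ℓ, l⟩ := iInf_lt_iff.1 l
    obtain ⟨p, l⟩ := iInf_lt_iff.1 l
    have hl : (ℓ : ℝ) ≤ ε := by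
      have := (ENNReal.coe_lt_coe.1 l).le
      exact (Real.le_toNNReal_iff_coe_le hε.le).1 this
    linarith [p.abs_apply_sub_le w]

end SimpleGraph.Realization

/-! ### Rips hyperbolicity -/

/-- `σ` is (the image of) a geodesic segment from `x` to `y`: there is an isometric map of a
compact interval `[a, b]` onto `σ` that maps `a` to `x` and `b` to `y`. -/
def IsGeodesicSegment {X : Type*} [EMetricSpace X] (x y : X) (σ : Set X) : Prop :=
  ∃ (a b : ℝ) (α : ℝ → X), a ≤ b ∧ α a = x ∧ α b = y ∧
    (∀ s ∈ Set.Icc a b, ∀ t ∈ Set.Icc a b, edist (α s) (α t) = edist s t) ∧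
    α '' Set.Icc a b = σ

/-- Rips hyperbolicity of a geodesic space: for some `δ ≥ 0`, every geodesic triangle is
`δ`-slim, that is, each side lies in the `δ`-neighbourhood of the union of the other two. -/
def IsRipsHyperbolic (X : Type*) [EMetricSpace X] : Prop :=
  ∃ δ : ℝ, 0 ≤ δ ∧ ∀ (x y z : X) (σ τ ρ : Set X),
    IsGeodesicSegment x y σ → IsGeodesicSegment x z τ → IsGeodesicSegment y z ρ →
    ∀ p ∈ σ, ∃ q ∈ τ ∪ ρ, edist p q ≤ ENNReal.ofReal δ

/-! ### Groups -/

/-- A group is hyperbolic if it has a finite generating set `S`, with `1 ∉ S` and `S⁻¹ = S`, such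
that its Cayley graph with respect to `S` (vertices the elements of the group, edges the pairs
`{g, g * s}` with `s ∈ S`, each of length one) is a Rips-hyperbolic space. -/
def IsHyperbolicGroup (G : Type*) [Group G] : Prop :=
  ∃ S : Set G, S.Finite ∧ Subgroup.closure S = ⊤ ∧ 1 ∉ S ∧ (∀ s ∈ S, s⁻¹ ∈ S) ∧
    IsRipsHyperbolic (SimpleGraph.mulCayley S).Realization

/-- A group is virtually cyclic if some subgroup of finite index is cyclic. In particular, finite
groups are virtually cyclic. -/
def IsVirtuallyCyclic (K : Type*) [Group K] : Prop :=
  ∃ C : Subgroup K, C.FiniteIndex ∧ IsCyclic C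

/-- A free group of rank two. -/
def IsFreeOfRankTwo (K : Type*) [Group K] : Prop :=
  Nonempty (K ≃* FreeGroup (Fin 2))

/-! The word metric satisfies Gromov's four-point inequality. After that only this inequality, left
invariance, finiteness of balls and integral interpolation are used (`IsGromovHyperbolicDist`); no
boundary at infinity is needed. Read on lengths (`four_point_length`), the inequality is a
local-to-global principle: if adjacent factors cancel little, so does the whole product. It yields
free subgroups (`isFreeOfRankTwo_closure`) and shows that an element whose square is clearly longer
than itself has powers of quasi-additive length, that is, a quasi-axis.

Every infinite subgroup contains a conjugate of such an element (`exists_loxodromic`): otherwise too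
many elements would move some point a bounded distance. For a cyclic subgroup this gives every
element of infinite order a power with a quasi-axis. Given two such axes, either some half-axes have
unbounded Gromov products, hence fellow-travel, and pigeonhole gives a common power
(`exists_zpow_eq_zpow`); or all products are bounded and high powers generate a free group.

In (1), a common power is central in the group generated by the pair. In (2), if there is no free
subgroup, a loxodromic `a` in `H` shares a power with each of its conjugates, so `H` commensurates
`a`. Commensurating elements stay uniformly near the axis (`exists_near_zpow`), so a cyclic subgroup
has finite index. -/

/-! ### Geodesics in the realization, and slim triangles on vertices -/

namespace SimpleGraph

variable {V : Type*} {Γ : SimpleGraph V}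

theorem Connected.dist_getVert_of_length_eq_dist (hΓ : Γ.Connected) {x y : V} (p : Γ.Walk x y)
    (hp : p.length = Γ.dist x y) {i : ℕ} (hi : i ≤ p.length) :
    Γ.dist x (p.getVert i) = i ∧ Γ.dist (p.getVert i) y = p.length - i := by
  have h₁ := dist_le (p.take i)
  have h₂ := dist_le (p.drop i)
  have h₃ := hΓ.dist_triangle (u := x) (v := p.getVert i) (w := y)
  rw [Walk.take_length] at h₁
  rw [Walk.drop_length] at h₂
  omega

namespace Realization

/-- The affine extension to the realization of the distance from the vertex `x`. -/
noncomputable def distFrom (x : V) (p : Γ.Realization) : ℝ :=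
  p.1.sum fun w c => c * (Γ.dist x w : ℝ)

theorem distFrom_of_eq (x u v : V) (s t : ℝ) (p : Γ.Realization)
    (hp : p.1 = Finsupp.single u s + Finsupp.single v t) :
    distFrom x p = s * Γ.dist x u + t * Γ.dist x v := by
  rw [distFrom, hp, Finsupp.sum_add_index' (by simp) (by intros; ring),
    Finsupp.sum_single_index (by simp), Finsupp.sum_single_index (by simp)]

theorem distFrom_vertex (x v : V) : distFrom x (vertex Γ v) = Γ.dist x v := by
  rw [distFrom_of_eq x v v 1 0 _ (by simp [vertex])]
  simp

/-- On an edge the function is affine with slope in `[-1, 1]`. The path metric is an infimum, so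
lower bounds for it have to come from a 1-Lipschitz function. -/
theorem HasPath.abs_distFrom_sub_le (hΓ : Γ.Connected) (x : V) {p q : Γ.Realization} {ℓ : ℝ≥0}
    (h : HasPath p q ℓ) : |distFrom x p - distFrom x q| ≤ ℓ := by
  induction h with
  | refl => simp
  | @cons u v h s t z ℓ _ ih =>
    have key : |distFrom x (edgePoint h s) - distFrom x (edgePoint h t)| ≤ |(s : ℝ) - t| := by
      rw [distFrom_of_eq x u v _ _ _ rfl, distFrom_of_eq x u v _ _ _ rfl]
      have e : (1 - (s : ℝ)) * Γ.dist x u + s * Γ.dist x v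
          - ((1 - (t : ℝ)) * Γ.dist x u + t * Γ.dist x v)
          = ((s : ℝ) - t) * ((Γ.dist x v : ℝ) - Γ.dist x u) := by ring
      rw [e, abs_mul]
      refine mul_le_of_le_one_right (abs_nonneg _) ?_
      have h₁ := hΓ.dist_triangle (u := x) (v := u) (w := v)
      have h₂ := hΓ.dist_triangle (u := x) (v := v) (w := u)
      have h₃ := dist_eq_one_iff_adj.2 h
      have h₄ := dist_eq_one_iff_adj.2 h.symm
      rw [h₃] at h₁
      rw [h₄] at h₂
      have h₁' : (Γ.dist x v : ℝ) ≤ Γ.dist x u + 1 := by exact_mod_cast h₁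
      have h₂' : (Γ.dist x u : ℝ) ≤ Γ.dist x v + 1 := by exact_mod_cast h₂
      rw [abs_le]
      constructor <;> linarith
    rw [NNReal.coe_add, coe_nndist, Subtype.dist_eq, Real.dist_eq]
    exact (abs_sub_le _ (distFrom x (edgePoint h t)) _).trans (add_le_add key ih)

theorem ofReal_abs_distFrom_sub_le (hΓ : Γ.Connected) (x : V) (p q : Γ.Realization) :
    ENNReal.ofReal |distFrom x p - distFrom x q| ≤ EDist.edist p q := by
  refine le_iInf₂ fun ℓ h => ?_
  rw [ENNReal.ofReal_le_iff_le_toReal (by simp)]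
  exact h.abs_distFrom_sub_le hΓ x

/-- The parametrization by arc length of a walk, as a path in the realization. -/
noncomputable def walkPoint {x y : V} (p : Γ.Walk x y) (s : ℝ) : Γ.Realization :=
  ⟨Finsupp.single (p.getVert ⌊s⌋₊) (1 - Int.fract s)
      + Finsupp.single (p.getVert (⌊s⌋₊ + 1)) (Int.fract s),
    p.getVert ⌊s⌋₊, p.getVert (⌊s⌋₊ + 1), by
      rcases lt_or_ge ⌊s⌋₊ p.length with h | h
      · exact Or.inr (p.adj_getVert_succ h)
      · left
        rw [p.getVert_of_length_le h, p.getVert_of_length_le (by omega)],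
    Int.fract s, ⟨Int.fract_nonneg s, (Int.fract_lt_one s).le⟩, rfl⟩

theorem walkPoint_natCast {x y : V} (p : Γ.Walk x y) (n : ℕ) :
    walkPoint p n = vertex Γ (p.getVert n) := by
  refine Subtype.ext ?_
  simp [walkPoint, vertex]

theorem walkPoint_eq_edgePoint {x y : V} (p : Γ.Walk x y) {i : ℕ} (hi : i < p.length) {s : ℝ}
    (h₁ : (i : ℝ) ≤ s) (h₂ : s ≤ i + 1) :
    walkPoint p s = edgePoint (p.adj_getVert_succ hi) ⟨s - i, by linarith, by linarith⟩ := by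
  rcases h₂.lt_or_eq with h₂ | h₂
  · have hf : ⌊s⌋₊ = i := (Nat.floor_eq_iff (i.cast_nonneg.trans h₁)).2 ⟨h₁, h₂⟩
    have hf' : Int.fract s = s - i := by
      rw [Int.fract_eq_iff]
      exact ⟨by linarith, by linarith, i, by push_cast; ring⟩
    refine Subtype.ext ?_
    simp [walkPoint, edgePoint, hf, hf']
  -- At the right endpoint the floor jumps to `i + 1`, but both descriptions give the same vertex.
  · have : s = ((i + 1 : ℕ) : ℝ) := by push_cast; exact h₂
    subst this
    rw [walkPoint_natCast]
    refine Subtype.ext ?_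
    simp [vertex, edgePoint]

theorem edist_walkPoint_le {x y : V} (p : Γ.Walk x y) (n : ℕ) (hn : n ≤ p.length) :
    ∀ s t : ℝ, 0 ≤ s → s ≤ t → t ≤ n →
      EDist.edist (walkPoint p s) (walkPoint p t) ≤ ENNReal.ofReal (t - s) := by
  induction n with
  | zero =>
    intro s t h₁ h₂ h₃
    have : s = t := by push_cast at h₃; linarith
    simp [this]
  | succ n ih =>
    have key : ∀ s t : ℝ, n ≤ s → s ≤ t → t ≤ n + 1 →
        EDist.edist (walkPoint p s) (walkPoint p t) ≤ ENNReal.ofReal (t - s) := by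
      intro s t h₁ h₂ h₃
      rw [walkPoint_eq_edgePoint p (i := n) (by omega) h₁ (by linarith),
        walkPoint_eq_edgePoint p (i := n) (by omega) (by linarith) h₃]
      refine (iInf₂_le _ (HasPath.cons _ _ _ (HasPath.refl _))).trans ?_
      rw [add_zero, ← ENNReal.ofReal_coe_nnreal]
      refine ENNReal.ofReal_le_ofReal ?_
      rw [coe_nndist, Subtype.dist_eq, Real.dist_eq, abs_sub_comm]
      rw [abs_of_nonneg (by simp; linarith)]
      simp
    intro s t h₁ h₂ h₃
    push_cast at h₃
    rcases le_total t n with h | h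
    · exact ih (by omega) s t h₁ h₂ h
    rcases le_total (n : ℝ) s with h' | h'
    · exact key s t h' h₂ h₃
    · refine (PseudoEMetricSpace.edist_triangle _ (walkPoint p n) _).trans ?_
      refine (add_le_add (ih (by omega) s n h₁ h' le_rfl) (key n t le_rfl h h₃)).trans_eq ?_
      rw [← ENNReal.ofReal_add (by linarith) (by linarith)]
      congr 1
      ring

theorem distFrom_walkPoint (hΓ : Γ.Connected) {x y : V} (p : Γ.Walk x y)
    (hp : p.length = Γ.dist x y) {s : ℝ} (h₀ : 0 ≤ s) (h₁ : s ≤ p.length) :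
    distFrom x (walkPoint p s) = s := by
  rcases h₁.lt_or_eq with h₁ | rfl
  · have hf : ⌊s⌋₊ < p.length := (Nat.floor_lt h₀).2 h₁
    have hf' : (Int.fract s) = s - ⌊s⌋₊ := by
      rw [Int.fract, natCast_floor_eq_intCast_floor h₀]
    rw [distFrom_of_eq x _ _ _ _ _ rfl, (hΓ.dist_getVert_of_length_eq_dist p hp hf.le).1,
      (hΓ.dist_getVert_of_length_eq_dist p hp (i := ⌊s⌋₊ + 1) hf).1, hf']
    push_cast
    ring
  · rw [walkPoint_natCast, distFrom_vertex, p.getVert_length, hp]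

theorem isGeodesicSegment_walkPoint (hΓ : Γ.Connected) {x y : V} (p : Γ.Walk x y)
    (hp : p.length = Γ.dist x y) :
    IsGeodesicSegment (vertex Γ x) (vertex Γ y) (walkPoint p '' Set.Icc 0 p.length) := by
  have key : ∀ s t : ℝ, 0 ≤ s → s ≤ t → t ≤ p.length →
      EDist.edist (walkPoint p s) (walkPoint p t) = EDist.edist s t := by
    intro s t h₁ h₂ h₃
    have e : EDist.edist s t = ENNReal.ofReal (t - s) := by
      rw [edist_dist, Real.dist_eq, abs_sub_comm, abs_of_nonneg (by linarith)]
    rw [e]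
    refine le_antisymm (edist_walkPoint_le p _ le_rfl s t h₁ h₂ h₃) ?_
    have := ofReal_abs_distFrom_sub_le hΓ x (walkPoint p s) (walkPoint p t)
    rwa [distFrom_walkPoint hΓ p hp h₁ (by linarith), distFrom_walkPoint hΓ p hp (by linarith) h₃,
      abs_sub_comm, abs_of_nonneg (by linarith)] at this
  refine ⟨0, p.length, walkPoint p, by positivity, ?_, ?_, ?_, rfl⟩
  · simpa using walkPoint_natCast p 0
  · simpa using walkPoint_natCast p p.length
  · intro s hs t ht
    rcases le_total s t with h | h
    · exact key s t hs.1 h ht.2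
    · rw [PseudoEMetricSpace.edist_comm, PseudoEMetricSpace.edist_comm s]
      exact key t s ht.1 h hs.2

end Realization

/-- Rips hyperbolicity of the realization, read on the vertices. -/
theorem exists_slim_of_isRipsHyperbolic (hΓ : Γ.Connected) (h : IsRipsHyperbolic Γ.Realization) :
    ∃ δ : ℝ, 0 ≤ δ ∧ ∀ x y z p : V, Γ.dist x p + Γ.dist p y = Γ.dist x y →
      ∃ q, (Γ.dist x q + Γ.dist q z = Γ.dist x z ∨ Γ.dist y q + Γ.dist q z = Γ.dist y z) ∧
        (Γ.dist p q : ℝ) ≤ δ := by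
  obtain ⟨δ, hδ, h⟩ := h
  -- The extra 1 pays for replacing a real point of the other side by the vertex at the floor of its
  -- parameter.
  refine ⟨δ + 1, by linarith, fun x y z p hp => ?_⟩
  obtain ⟨w₁, hw₁⟩ := hΓ.exists_walk_length_eq_dist x p
  obtain ⟨w₂, hw₂⟩ := hΓ.exists_walk_length_eq_dist p y
  obtain ⟨v₁, hv₁⟩ := hΓ.exists_walk_length_eq_dist x z
  obtain ⟨v₂, hv₂⟩ := hΓ.exists_walk_length_eq_dist y z
  have hw : (w₁.append w₂).length = Γ.dist x y := by rw [Walk.length_append]; omega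
  have hmem : Realization.vertex Γ p ∈
      Realization.walkPoint (w₁.append w₂) '' Set.Icc 0 (w₁.append w₂).length := by
    refine ⟨w₁.length, ⟨by positivity, by simp⟩, ?_⟩
    rw [Realization.walkPoint_natCast, Walk.getVert_append]
    simp
  have aux : ∀ {a b : V} (w : Γ.Walk a b), w.length = Γ.dist a b →
      ∀ q ∈ Realization.walkPoint w '' Set.Icc 0 w.length,
      EDist.edist (Realization.vertex Γ p) q ≤ ENNReal.ofReal δ →
      ∃ q, Γ.dist a q + Γ.dist q b = Γ.dist a b ∧ (Γ.dist p q : ℝ) ≤ δ + 1 := by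
    rintro a b w hw _ ⟨s, ⟨hs₀, hs₁⟩, rfl⟩ hq
    have hf : ⌊s⌋₊ ≤ w.length := Nat.floor_le_of_le hs₁
    have hd := hΓ.dist_getVert_of_length_eq_dist w hw hf
    refine ⟨w.getVert ⌊s⌋₊, by omega, ?_⟩
    have h₁ := (Realization.ofReal_abs_distFrom_sub_le hΓ p _ _).trans hq
    rw [ENNReal.ofReal_le_ofReal_iff hδ, Realization.distFrom_vertex, dist_self] at h₁
    have h₂ := (Realization.ofReal_abs_distFrom_sub_le hΓ p _ _).trans
      (Realization.edist_walkPoint_le w w.length le_rfl ⌊s⌋₊ s (by positivity)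
        (Nat.floor_le hs₀) hs₁)
    rw [ENNReal.ofReal_le_ofReal_iff (by linarith [Nat.floor_le hs₀]),
      Realization.walkPoint_natCast, Realization.distFrom_vertex] at h₂
    have h₃ := Nat.lt_floor_add_one s
    rw [abs_le] at h₁ h₂
    push_cast at h₁
    linarith
  obtain ⟨q, hq | hq, hpq⟩ := h _ _ (Realization.vertex Γ z) _ _ _
    (Realization.isGeodesicSegment_walkPoint hΓ _ hw)
    (Realization.isGeodesicSegment_walkPoint hΓ v₁ hv₁)
    (Realization.isGeodesicSegment_walkPoint hΓ v₂ hv₂) _ hmem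
  · obtain ⟨r, hr, hpr⟩ := aux v₁ hv₁ q hq hpq
    exact ⟨r, Or.inl hr, hpr⟩
  · obtain ⟨r, hr, hpr⟩ := aux v₂ hv₂ q hq hpq
    exact ⟨r, Or.inr hr, hpr⟩

end SimpleGraph

/-! ### The four-point inequality, and the geometry of Cayley graphs -/

namespace SimpleGraph

variable {V : Type*} {Γ : SimpleGraph V}

/-- Gromov's four-point inequality for the vertices of a Rips-hyperbolic graph. -/
theorem exists_four_point_of_isRipsHyperbolic (hΓ : Γ.Connected)
    (h : IsRipsHyperbolic Γ.Realization) :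
    ∃ δ : ℝ, 0 ≤ δ ∧ ∀ x y z w : V,
      (Γ.dist x z : ℝ) + Γ.dist y w ≤ Γ.dist x y + Γ.dist z w + 2 * δ ∨
      (Γ.dist x z : ℝ) + Γ.dist y w ≤ Γ.dist x w + Γ.dist y z + 2 * δ := by
  obtain ⟨δ, hδ, h⟩ := exists_slim_of_isRipsHyperbolic hΓ h
  have tri : ∀ x y z : V, (Γ.dist x z : ℝ) ≤ Γ.dist x y + Γ.dist y z := fun x y z => by
    exact_mod_cast hΓ.dist_triangle
  have comm : ∀ x y : V, (Γ.dist x y : ℝ) = Γ.dist y x := fun x y => by rw [dist_comm]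
  refine ⟨3 * δ + 1, by linarith, fun x y z w => ?_⟩
  -- Some point of `[x, z]` realizes the Gromov product of `x` and `z` at `w` up to `2δ + 1`. Moving
  -- from `x` to `z`, a vertex near `[z, w]` whose predecessor is near `[x, w]` would do; if there
  -- is none, even `z` is near `[x, w]`, and then `z` itself does.
  have near : ∃ p, Γ.dist x p + Γ.dist p z = Γ.dist x z ∧
      2 * (Γ.dist w p : ℝ) ≤ Γ.dist w x + Γ.dist w z - Γ.dist x z + 4 * δ + 2 := by
    obtain ⟨v, hv⟩ := hΓ.exists_walk_length_eq_dist x z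
    by_contra! hcon
    have key : ∀ i ≤ v.length, ∃ q, Γ.dist x q + Γ.dist q w = Γ.dist x w ∧
        (Γ.dist (v.getVert i) q : ℝ) ≤ δ := by
      intro i
      induction i with
      | zero => exact fun _ => ⟨x, by simp, by simpa using hδ⟩
      | succ i ih =>
        intro hi
        obtain ⟨q, hq, hq'⟩ := ih (by omega)
        have hd := hΓ.dist_getVert_of_length_eq_dist v hv hi
        have hd' := hΓ.dist_getVert_of_length_eq_dist v hv (i := i) (by omega)
        have hb : Γ.dist x (v.getVert (i + 1)) + Γ.dist (v.getVert (i + 1)) z = Γ.dist x z := by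
          omega
        have hc := hcon _ hb
        obtain ⟨r, hr | hr, hr'⟩ := h x z w _ hb
        · exact ⟨r, hr, hr'⟩
        · exfalso
          have ha := dist_eq_one_iff_adj.2 (v.adj_getVert_succ (i := i) (by omega))
          set P := v.getVert (i + 1)
          set P' := v.getVert i
          have hb' : (Γ.dist x P : ℝ) + Γ.dist P z = Γ.dist x z := by exact_mod_cast hb
          have hq₁ : (Γ.dist x q : ℝ) + Γ.dist q w = Γ.dist x w := by exact_mod_cast hq
          have hr₁ : (Γ.dist z r : ℝ) + Γ.dist r w = Γ.dist z w := by exact_mod_cast hr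
          have ha' : (Γ.dist P' P : ℝ) = 1 := by exact_mod_cast ha
          linarith [tri w q P, tri q P' P, tri x P' P, tri x q P', tri w r P, tri z r P,
            comm w q, comm q P', comm w r, comm r P, comm P z, comm w x, comm w z, tri P P' x,
            comm P P', comm P x, comm P' x]
    obtain ⟨q, hq, hq'⟩ := key _ le_rfl
    rw [v.getVert_length] at hq'
    have hc := hcon z (by simp)
    have hq₁ : (Γ.dist x q : ℝ) + Γ.dist q w = Γ.dist x w := by exact_mod_cast hq
    linarith [tri w q z, tri x q z, comm w q, comm q z, comm w x]
  obtain ⟨p, hp, hwp⟩ := near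
  obtain ⟨q, hq | hq, hpq⟩ := h x z y p hp
  · left
    have hq₁ : (Γ.dist x q : ℝ) + Γ.dist q y = Γ.dist x y := by exact_mod_cast hq
    linarith [tri w p q, tri w q x, tri w q y, comm q x, comm y w, comm z w]
  · right
    have hq₁ : (Γ.dist z q : ℝ) + Γ.dist q y = Γ.dist z y := by exact_mod_cast hq
    linarith [tri w p q, tri w q z, tri w q y, comm q z, comm y w, comm x w, comm y z]

variable {G : Type*} [Group G] {S : Set G}

theorem mulCayley_connected (hS : Subgroup.closure S = ⊤) : (mulCayley S).Connected := by
  have key : ∀ g x : G, (mulCayley S).Reachable x (x * g) := by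
    intro g
    have hg : g ∈ Subgroup.closure S := by rw [hS]; trivial
    induction hg using Subgroup.closure_induction with
    | mem s hs =>
      intro x
      by_cases h : x = x * s
      · rw [← h]
      · exact Adj.reachable ((mulCayley_adj' _ _ _).2 ⟨h, s, hs, Or.inl rfl⟩)
    | one => intro x; simp
    | mul a b _ _ iha ihb =>
      intro x
      rw [← mul_assoc]
      exact (iha x).trans (ihb _)
    | inv a _ iha =>
      intro x
      simpa using (iha (x * a⁻¹)).symm
  exact ⟨fun x y => by simpa using key (x⁻¹ * y) x⟩

theorem mulCayley_dist_mul_left (hS : Subgroup.closure S = ⊤) (g x y : G) :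
    (mulCayley S).dist (g * x) (g * y) = (mulCayley S).dist x y := by
  have key : ∀ g x y : G, (mulCayley S).dist (g * x) (g * y) ≤ (mulCayley S).dist x y := by
    intro g x y
    obtain ⟨p, hp⟩ := (mulCayley_connected hS).exists_walk_length_eq_dist x y
    let f : mulCayley S →g mulCayley S := ⟨fun x => g * x, fun h => mulCayley_adj_mul_iff_right.2 h⟩
    rw [← hp, ← p.length_map f]
    exact dist_le _
  refine le_antisymm (key g x y) ?_
  simpa using key g⁻¹ (g * x) (g * y)

theorem finite_mulCayley_ball (hS : Subgroup.closure S = ⊤) (hfin : S.Finite)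
    (hinv : ∀ s ∈ S, s⁻¹ ∈ S) (n : ℕ) : {x : G | (mulCayley S).dist 1 x ≤ n}.Finite := by
  have hc := mulCayley_connected hS
  induction n with
  | zero =>
    refine (Set.finite_singleton (1 : G)).subset fun x hx => ?_
    exact ((hc.dist_eq_zero_iff).1 (Nat.le_zero.1 hx)).symm
  | succ n ih =>
    refine (ih.union (ih.mul hfin)).subset fun x hx => ?_
    rcases Nat.le_or_eq_of_le_succ hx with h | h
    · exact Or.inl h
    · obtain ⟨p, hp⟩ := hc.exists_walk_length_eq_dist 1 x
      have hn : n < p.length := by omega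
      have hd := hc.dist_getVert_of_length_eq_dist p hp hn.le
      have ha := p.adj_getVert_succ hn
      rw [p.getVert_of_length_le (by omega : p.length ≤ n + 1)] at ha
      obtain ⟨-, s, hs, e | e⟩ := (mulCayley_adj' _ _ _).1 ha
      · exact Or.inr (Set.mem_mul.2 ⟨_, hd.1.le, s, hs, e⟩)
      · exact Or.inr (Set.mem_mul.2 ⟨_, hd.1.le, s⁻¹, hinv s hs, by rw [e]; simp⟩)

end SimpleGraph

/-! ### Hyperbolic length functions: free subgroups and quasi-additive powers -/

/-- A left-invariant pseudometric on a group with finite balls, with points at every integral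
distance between two given points, and which satisfies Gromov's four-point inequality. -/
structure IsGromovHyperbolicDist {G : Type*} [Group G] (d : G → G → ℝ) (δ : ℝ) : Prop where
  delta_nonneg : 0 ≤ δ
  self (x : G) : d x x = 0
  comm (x y : G) : d x y = d y x
  triangle (x y z : G) : d x z ≤ d x y + d y z
  mul_left (g x y : G) : d (g * x) (g * y) = d x y
  finite_ball (r : ℝ) : {x | d 1 x ≤ r}.Finite
  exists_between (x y : G) (n : ℕ) : n ≤ d x y → ∃ u, d x u = n ∧ d u y = d x y - n
  four_point (x y z w : G) : d x z + d y w ≤ d x y + d z w + 2 * δ ∨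
    d x z + d y w ≤ d x w + d y z + 2 * δ

theorem IsHyperbolicGroup.exists_isGromovHyperbolicDist {G : Type*} [Group G]
    (hG : IsHyperbolicGroup G) : ∃ (d : G → G → ℝ) (δ : ℝ), IsGromovHyperbolicDist d δ := by
  obtain ⟨S, hfin, hS, -, hinv, hR⟩ := hG
  have hc := SimpleGraph.mulCayley_connected hS
  obtain ⟨δ, hδ, h⟩ := SimpleGraph.exists_four_point_of_isRipsHyperbolic hc hR
  refine ⟨fun x y => ((SimpleGraph.mulCayley S).dist x y : ℝ), δ, ⟨hδ, ?_, ?_, ?_, ?_, ?_, ?_, h⟩⟩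
  · simp
  · intro x y
    rw [SimpleGraph.dist_comm]
  · intro x y z
    exact_mod_cast hc.dist_triangle
  · intro g x y
    rw [SimpleGraph.mulCayley_dist_mul_left hS]
  · intro r
    refine (SimpleGraph.finite_mulCayley_ball hS hfin hinv ⌊r⌋₊).subset fun x hx => ?_
    exact Nat.le_floor hx
  · intro x y n hn
    obtain ⟨p, hp⟩ := hc.exists_walk_length_eq_dist x y
    have hn' : n ≤ p.length := by rw [hp]; exact_mod_cast hn
    have hd := hc.dist_getVert_of_length_eq_dist p hp hn'
    refine ⟨p.getVert n, by rw [hd.1], ?_⟩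
    rw [hd.2, Nat.cast_sub hn', hp]

/-- The lengths of the powers of `g` are additive up to a bounded error. -/
def IsQuasiAdditive {G : Type*} [Group G] (d : G → G → ℝ) (g : G) : Prop :=
  ∃ C : ℝ, 0 ≤ C ∧ ∀ i j : ℕ, d 1 (g ^ i) + d 1 (g ^ j) ≤ d 1 (g ^ (i + j)) + C

namespace IsGromovHyperbolicDist

variable {G : Type*} [Group G] {d : G → G → ℝ} {δ : ℝ}

theorem eq_length (h : IsGromovHyperbolicDist d δ) (x y : G) : d x y = d 1 (x⁻¹ * y) := by
  rw [← h.mul_left x⁻¹ x y, inv_mul_cancel]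

theorem length_inv (h : IsGromovHyperbolicDist d δ) (x : G) : d 1 x⁻¹ = d 1 x := by
  rw [h.comm 1 x, h.eq_length x 1, mul_one]

theorem nonneg (h : IsGromovHyperbolicDist d δ) (x y : G) : 0 ≤ d x y := by
  linarith [h.triangle x y x, h.self x, h.comm x y]

theorem length_mul_le (h : IsGromovHyperbolicDist d δ) (x y : G) : d 1 (x * y) ≤ d 1 x + d 1 y := by
  have := h.triangle 1 x (x * y)
  rwa [h.eq_length x (x * y), inv_mul_cancel_left] at this

/-- This is the four-point inequality at `1`, `x⁻¹`, `y * z`, `y`. In applications the first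
alternative is excluded and the second bounds `x * y * z` from below. -/
theorem four_point_length (h : IsGromovHyperbolicDist d δ) (x y z : G) :
    d 1 (y * z) + d 1 (x * y) ≤ d 1 x + d 1 z + 2 * δ ∨
      d 1 (y * z) + d 1 (x * y) ≤ d 1 y + d 1 (x * y * z) + 2 * δ := by
  have := h.four_point 1 x⁻¹ (y * z) y
  rwa [h.eq_length x⁻¹ y, h.eq_length x⁻¹ (y * z), h.comm (y * z) y, h.eq_length y (y * z),
    inv_inv, inv_mul_cancel_left, h.length_inv, ← mul_assoc] at this

/-- Induction with `four_point_length` for the first two letters and the rest: growth of the tail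
and the first chain inequality exclude one alternative, and the second chain inequality makes the
other a gain of 1. -/
theorem length_prod_add_one_le (h : IsGromovHyperbolicDist d δ) (a : G) (L : List G)
    (h₁ : ∀ b ∈ a :: L, 1 ≤ d 1 b)
    (h₂ : (a :: L).IsChain fun a b => d 1 a + 2 * δ + 1 ≤ d 1 (a * b) ∧
      d 1 b + 2 * δ + 1 ≤ d 1 (a * b)) :
    d 1 L.prod + 1 ≤ d 1 (a :: L).prod := by
  induction L generalizing a with
  | nil => simpa [h.self] using h₁ a (by simp)
  | cons b L ih =>
    rw [List.isChain_cons_cons] at h₂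
    have := ih b (fun c hc => h₁ c (List.mem_cons_of_mem _ hc)) h₂.2
    rw [List.prod_cons] at this
    rw [List.prod_cons, List.prod_cons]
    rcases h.four_point_length a b L.prod with h' | h'
    · linarith [h₂.1.1]
    · rw [List.prod_cons, ← mul_assoc]
      linarith [h₂.1.2]

theorem isFreeOfRankTwo_closure (h : IsGromovHyperbolicDist d δ) (a b : G)
    (ha : d 1 a + 2 * δ + 1 ≤ d 1 (a * a)) (hb : d 1 b + 2 * δ + 1 ≤ d 1 (b * b))
    (hab : ∀ x y : G, (x = a ∨ x = a⁻¹) → (y = b ∨ y = b⁻¹) →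
      d 1 a + 2 * δ + 1 ≤ d 1 (x * y) ∧ d 1 b + 2 * δ + 1 ≤ d 1 (x * y)) :
    IsFreeOfRankTwo (Subgroup.closure {a, b}) := by
  have hδ := h.delta_nonneg
  have inv_len : ∀ x y : G, d 1 (x * y) = d 1 (y⁻¹ * x⁻¹) := fun x y => by
    rw [← mul_inv_rev, h.length_inv]
  have ha₁ : 1 ≤ d 1 a := by linarith [h.length_mul_le a a]
  have hb₁ : 1 ≤ d 1 b := by linarith [h.length_mul_le b b]
  let f : Fin 2 → G := ![a, b]
  let v : Fin 2 × Bool → G := fun x => cond x.2 (f x.1) (f x.1)⁻¹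
  have hv : ∀ x y : Fin 2 × Bool, (x.1 = y.1 → x.2 = y.2) →
      d 1 (v x) + 2 * δ + 1 ≤ d 1 (v x * v y) ∧ d 1 (v y) + 2 * δ + 1 ≤ d 1 (v x * v y) := by
    have h₁ := hab a b (Or.inl rfl) (Or.inl rfl)
    have h₂ := hab a b⁻¹ (Or.inl rfl) (Or.inr rfl)
    have h₃ := hab a⁻¹ b (Or.inr rfl) (Or.inl rfl)
    have h₄ := hab a⁻¹ b⁻¹ (Or.inr rfl) (Or.inr rfl)
    -- Inversion keeps lengths and reverses products, which covers the pairs beginning with `b` or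
    -- `b⁻¹` and the squares of inverses.
    have e₁ := inv_len b a
    have e₂ := inv_len b a⁻¹
    have e₃ := inv_len b⁻¹ a
    have e₄ := inv_len b⁻¹ a⁻¹
    have e₅ := inv_len a⁻¹ a⁻¹
    have e₆ := inv_len b⁻¹ b⁻¹
    simp only [inv_inv] at e₁ e₂ e₃ e₄ e₅ e₆
    rintro ⟨i, s⟩ ⟨j, t⟩ hst
    fin_cases i <;> fin_cases j <;> cases s <;> cases t <;>
      simp [v, f, h.length_inv] at hst ⊢ <;> try constructor
    all_goals linarith
  have hv₁ : ∀ x, 1 ≤ d 1 (v x) := by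
    rintro ⟨i, s⟩
    fin_cases i <;> cases s <;> simpa [v, f, h.length_inv]
  have hinj : Function.Injective (FreeGroup.lift f) := by
    refine (injective_iff_map_eq_one _).2 fun w hw => ?_
    by_contra hne
    have hw' : (w.toWord.map v).prod = 1 := by
      rw [← hw]
      conv_rhs => rw [← FreeGroup.mk_toWord (x := w), FreeGroup.lift_mk]
    have hred := FreeGroup.isReduced_toWord (x := w)
    obtain ⟨c, L, hL⟩ := List.exists_cons_of_ne_nil (mt FreeGroup.toWord_eq_nil_iff.1 hne)
    rw [hL] at hw' hred
    have := h.length_prod_add_one_le (v c) (L.map v) (by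
      intro x hx
      rw [← List.map_cons, List.mem_map] at hx
      obtain ⟨y, -, rfl⟩ := hx
      exact hv₁ y) (by
      rw [← List.map_cons, List.isChain_map]
      exact List.IsChain.imp (fun x y hxy => hv x y hxy) hred)
    rw [← List.map_cons, hw', h.self] at this
    linarith [h.nonneg 1 (L.map v).prod]
  have hrange : (FreeGroup.lift f).range = Subgroup.closure {a, b} := by
    rw [FreeGroup.range_lift_eq_closure]
    congr 1
    simp [f, Set.pair_comm]
  refine ⟨((FreeGroup.lift f).ofInjective hinj |>.trans (MulEquiv.subgroupCongr hrange)).symm⟩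

theorem eventually_lt_length_pow (h : IsGromovHyperbolicDist d δ) {g : G} (hg : ¬ IsOfFinOrder g)
    (r : ℝ) : ∀ᶠ n : ℕ in Filter.atTop, r < d 1 (g ^ n) := by
  have := (h.finite_ball r).preimage (injective_pow_iff_not_isOfFinOrder.2 hg).injOn
  rw [← Nat.cofinite_eq_atTop]
  filter_upwards [this.compl_mem_cofinite] with n hn
  simpa using hn

/-- The margin `3δ + 1` makes the lengths of the powers grow by `δ + 1` at each step. Two such steps
exceed `2δ`, which excludes the bad alternative for `g ^ j`, `g`, `g ^ i`. -/
theorem isQuasiAdditive_of_length_mul_self (h : IsGromovHyperbolicDist d δ) {g : G}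
    (hg : d 1 g + 3 * δ + 1 ≤ d 1 (g * g)) : IsQuasiAdditive d g ∧ ¬ IsOfFinOrder g := by
  have hδ := h.delta_nonneg
  have grow : ∀ n : ℕ, d 1 (g ^ n) + (δ + 1) ≤ d 1 (g ^ (n + 1)) := by
    intro n
    induction n with
    | zero =>
      rw [pow_zero, h.self, zero_add, zero_add, pow_one]
      linarith [h.length_mul_le g g]
    | succ n ih =>
      have := h.four_point_length g g (g ^ n)
      rw [mul_assoc, ← pow_succ', ← pow_succ'] at this
      rcases this with h' | h' <;> linarith
  refine ⟨⟨d 1 g + 2 * δ, by linarith [h.nonneg 1 g], fun i j => ?_⟩, fun hfin => ?_⟩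
  · rcases i with - | i
    · simp only [pow_zero, h.self, zero_add]
      linarith [h.nonneg 1 g]
    · have := h.four_point_length (g ^ j) g (g ^ i)
      rw [← pow_succ, ← pow_succ', ← pow_add, (by omega : j + 1 + i = i + 1 + j)] at this
      rcases this with h' | h'
      · linarith [grow i, grow j]
      · linarith [grow j]
  · obtain ⟨n, hn, hn'⟩ := isOfFinOrder_iff_pow_eq_one.1 hfin
    have : ∀ m : ℕ, 0 < m → 0 < d 1 (g ^ m) := by
      intro m hm
      obtain ⟨k, rfl⟩ := Nat.exists_eq_succ_of_ne_zero hm.ne'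
      linarith [grow k, h.nonneg 1 (g ^ k)]
    have := this n hn
    rw [hn', h.self] at this
    exact lt_irrefl _ this

theorem isQuasiAdditive_conj (h : IsGromovHyperbolicDist d δ) {g : G} (u : G)
    (hg : IsQuasiAdditive d (u⁻¹ * g * u)) : IsQuasiAdditive d g := by
  obtain ⟨C, hC, hg⟩ := hg
  have e : ∀ n : ℕ, (u⁻¹ * g * u) ^ n = u⁻¹ * g ^ n * u := fun n => by
    simpa using conj_pow (a := u⁻¹) (b := g) (i := n)
  have h₁ : ∀ x : G, d 1 (u⁻¹ * x * u) ≤ d 1 x + 2 * d 1 u := fun x => by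
    linarith [h.length_mul_le (u⁻¹ * x) u, h.length_mul_le u⁻¹ x, h.length_inv u]
  have h₂ : ∀ x : G, d 1 x ≤ d 1 (u⁻¹ * x * u) + 2 * d 1 u := fun x => by
    have := h.length_mul_le (u * (u⁻¹ * x * u)) u⁻¹
    have h' := h.length_mul_le u (u⁻¹ * x * u)
    rw [show u * (u⁻¹ * x * u) * u⁻¹ = x by group] at this
    linarith [h.length_inv u]
  refine ⟨C + 6 * d 1 u, by linarith [h.nonneg 1 u], fun i j => ?_⟩
  have := hg i j
  rw [e, e, e] at this
  linarith [h₂ (g ^ i), h₂ (g ^ j), h₁ (g ^ (i + j))]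

end IsGromovHyperbolicDist

theorem IsQuasiAdditive.pow {G : Type*} [Group G] {d : G → G → ℝ} {g : G}
    (hg : IsQuasiAdditive d g) (k : ℕ) : IsQuasiAdditive d (g ^ k) := by
  obtain ⟨C, hC, hg⟩ := hg
  refine ⟨C, hC, fun i j => ?_⟩
  rw [← pow_mul, ← pow_mul, ← pow_mul, mul_add]
  exact hg _ _

theorem IsGromovHyperbolicDist.isQuasiAdditive_inv {G : Type*} [Group G] {d : G → G → ℝ} {δ : ℝ}
    (h : IsGromovHyperbolicDist d δ) {g : G} (hg : IsQuasiAdditive d g) :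
    IsQuasiAdditive d g⁻¹ := by
  obtain ⟨C, hC, hg⟩ := hg
  refine ⟨C, hC, fun i j => ?_⟩
  rw [inv_pow, inv_pow, inv_pow, h.length_inv, h.length_inv, h.length_inv]
  exact hg i j

/-! ### Loxodromic elements in infinite subgroups -/

namespace IsGromovHyperbolicDist

variable {G : Type*} [Group G] {d : G → G → ℝ} {δ : ℝ}

/-- If `a`, `b` and `a * b` are not (visibly) loxodromic and `b` is long, then `a` displaces the
points well inside the first half of a geodesic from `1` to `b` by a bounded amount, unless `a`
is (visibly) loxodromic at such a point. -/
theorem displacement_le (h : IsGromovHyperbolicDist d δ) {κ : ℝ} (hκ : 0 ≤ κ) {a b u : G}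
    (hb : d 1 (b * b) < d 1 b + κ) (hab : d 1 (a * b * (a * b)) < d 1 (a * b) + κ)
    (hu : d 1 u + d u b = d 1 b) (ha : d u (a * (a * u)) < d u (a * u) + κ)
    (h₁ : d 1 a + δ < d 1 u) (h₂ : 2 * d 1 u + 4 * d 1 a + κ + 16 * δ < d 1 b) :
    d u (a * u) ≤ 14 * δ + κ := by
  have hδ := h.delta_nonneg
  have ia := h.length_inv a
  have ib := h.length_inv b
  have iab := h.length_inv (a * b)
  have lab := h.length_mul_le a b
  have lab' : d 1 b ≤ d 1 a + d 1 (a * b) := by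
    simpa [ia] using h.length_mul_le a⁻¹ (a * b)
  -- As squaring hardly lengthens `b` and `a * b`, each shares about half its length with its
  -- inverse; the two inverses are `d 1 a` apart. So geodesics from `1` to `b` and to `a * b` share
  -- about their first halves.
  have X : d b (a * b) ≤ d 1 b + d 1 a + κ + 4 * δ := by
    have e₁ : d b b⁻¹ = d 1 (b * b) := by
      rw [h.comm, h.eq_length, inv_inv]
    have e₂ : d (a * b)⁻¹ (a * b) = d 1 (a * b * (a * b)) := by
      rw [h.eq_length, inv_inv]
    have e₃ : d b⁻¹ (a * b)⁻¹ = d 1 a := by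
      rw [h.eq_length]; simp [ia]
    have f₁ := h.four_point b b⁻¹ (a * b) 1
    have f₂ := h.four_point b⁻¹ (a * b)⁻¹ (a * b) 1
    rw [h.comm b⁻¹ 1, h.comm (a * b) 1, h.comm b 1, ib, e₁] at f₁
    rw [h.comm (a * b)⁻¹ 1, h.comm (a * b) 1, h.comm b⁻¹ 1, ib, iab, e₂, e₃] at f₂
    rcases f₁ with f₁ | f₁ <;> rcases f₂ with f₂ | f₂ <;> linarith [h.nonneg 1 a, h.nonneg 1 b]
  have ea : d a (a * u) = d 1 u := by simpa using h.mul_left a 1 u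
  have eab : d (a * u) (a * b) = d u b := h.mul_left a u b
  have eaab : d a (a * b) = d 1 b := by simpa using h.mul_left a 1 b
  have eb' : d (a * (a * u)) b = d (a * u) (a⁻¹ * b) := by
    simpa using h.mul_left a (a * u) (a⁻¹ * b)
  have eb : d (a * u) b = d u (a⁻¹ * b) := by
    simpa using h.mul_left a u (a⁻¹ * b)
  have ebb : d (a * b) b = d b (a⁻¹ * b) := by
    simpa using h.mul_left a b (a⁻¹ * b)
  set v := a * u with hv
  have lv : d 1 v ≤ d 1 a + d 1 u := h.length_mul_le a u
  have lv' : d 1 u ≤ d 1 a + d 1 v := by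
    simpa [ia, hv] using h.length_mul_le a⁻¹ v
  have laav : d 1 (a * v) ≤ d 1 a + d 1 v := h.length_mul_le a v
  -- `v` lies on `[a, a * b]`, beyond the part near `a` by `h₁` and within the shared half by `h₂`
  -- and `X`, so it is almost on `[1, b]`.
  have near : d 1 v + d v b ≤ d 1 b + 4 * δ := by
    have f₁ := h.four_point a 1 (a * b) v
    have f₂ := h.four_point 1 b (a * b) v
    rw [eaab, h.comm a 1, h.comm (a * b) v, eab, ea] at f₁
    rw [h.comm b v, h.comm (a * b) v, eab] at f₂
    have t := h.triangle 1 v b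
    rcases f₁ with f₁ | f₁
    · linarith
    rcases f₂ with f₂ | f₂
    · linarith
    · linarith
  have huv₁ : d u v ≤ |d v b - d u b| + 6 * δ := by
    have f := h.four_point u 1 v b
    rw [h.comm u 1] at f
    rcases f with f | f
    · linarith [le_abs_self (d v b - d u b)]
    · linarith [neg_abs_le (d v b - d u b)]
  have hs : |d v b - d u b| ≤ d 1 a + 4 * δ := by
    rw [abs_le]
    constructor <;> linarith [h.triangle 1 v b]
  -- Towards `b`, `a` acts as a coarse translation: the second step, from `v` to `a * v`, shifts the
  -- distance to `b` as much as the first.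
  have hss : 2 * |d v b - d u b| ≤ |d (a * v) b - d u b| + 2 * δ := by
    have f₁ := h.four_point u v (a⁻¹ * b) b
    have f₂ := h.four_point u v b (a⁻¹ * b)
    rw [h.comm (a⁻¹ * b) b] at f₁
    rw [← eb, ← ebb, ← eb', h.comm (a * b) b] at f₁ f₂
    have t₁ := h.triangle 1 v b
    have t₂ := h.triangle 1 (a * v) b
    have g₁ : 2 * d v b ≤ d u b + d (a * v) b + 2 * δ := by
      rcases f₁ with f₁ | f₁ <;> linarith
    have g₂ : d u b + d (a * v) b ≤ 2 * d v b + 2 * δ := by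
      rcases f₂ with f₂ | f₂ <;> linarith
    rcases abs_cases (d v b - d u b) with c | c <;>
      rcases abs_cases (d (a * v) b - d u b) with c' | c' <;> linarith
  have hlow : |d (a * v) b - d u b| ≤ d u (a * v) := by
    rw [abs_le]
    constructor <;> linarith [h.triangle u (a * v) b, h.triangle (a * v) u b, h.comm u (a * v)]
  -- By `ha`, twice the shift is at most `d u v + κ + 2δ`, hence at most the shift plus `κ + 8δ`. So
  -- the shift is at most `κ + 8δ`, and `huv₁` adds `6δ`.
  linarith

/-- An infinite subgroup contains an element which is loxodromic, as seen from some point. -/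
theorem exists_loxodromic (h : IsGromovHyperbolicDist d δ) (H : Subgroup G)
    (hH : (H : Set G).Infinite) :
    ∃ a ∈ H, ∃ u : G, d 1 (u⁻¹ * a * u) + 3 * δ + 1 ≤ d 1 (u⁻¹ * a * u * (u⁻¹ * a * u)) := by
  by_contra! hcon
  have hδ := h.delta_nonneg
  set κ := 3 * δ + 1 with hκ
  have hone : ∀ a ∈ H, d 1 (a * a) < d 1 a + κ := fun a ha => by
    have := hcon a ha 1
    simp only [inv_one, one_mul, mul_one] at this
    linarith
  -- Choose more elements of `H` than this ball has. At a suitable `u` on a long geodesic, all their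
  -- conjugates by `u` land in the ball, contradicting injectivity of conjugation.
  have hK := h.finite_ball (14 * δ + κ)
  obtain ⟨F, hFH, hF⟩ := hH.exists_subset_card_eq (hK.toFinset.card + 1)
  obtain ⟨R, hR⟩ := (F.finite_toSet.image fun a => d 1 a).bddAbove
  have hR' : ∀ a ∈ F, d 1 a ≤ R := fun a ha => hR ⟨a, ha, rfl⟩
  obtain ⟨a₀, ha₀⟩ : F.Nonempty := Finset.card_pos.1 (by omega)
  have hR₀ : 0 ≤ R := (h.nonneg 1 a₀).trans (hR' a₀ ha₀)
  set t := ⌊R + δ⌋₊ + 1 with ht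
  have ht' : R + δ < t := by
    rw [ht]; push_cast; exact Nat.lt_floor_add_one _
  obtain ⟨b, hb, hb'⟩ : ∃ b ∈ H, 2 * t + 4 * R + κ + 16 * δ < d 1 b := by
    by_contra! hall
    exact hH ((h.finite_ball _).subset fun x hx => hall x hx)
  obtain ⟨u, hu, hub⟩ := h.exists_between 1 b t (by linarith)
  obtain ⟨x, hx, y, hy, hxy, e⟩ := Finset.exists_ne_map_eq_of_card_lt_of_maps_to
    (s := F) (t := hK.toFinset) (f := fun a => u⁻¹ * a * u) (by omega) (by
      intro a ha
      have haH : a ∈ H := hFH ha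
      rw [Finset.mem_coe, Set.Finite.mem_toFinset, Set.mem_ofPred_eq]
      have e₁ : d u (a * u) = d 1 (u⁻¹ * a * u) := by rw [h.eq_length, mul_assoc]
      have e₂ : d u (a * (a * u)) = d 1 (u⁻¹ * a * u * (u⁻¹ * a * u)) := by
        rw [h.eq_length]; congr 1; group
      rw [← e₁]
      have hR'' := hR' a ha
      refine h.displacement_le (κ := κ) (b := b) (by linarith) (hone b hb) (hone _ (H.mul_mem haH hb)) ?_ ?_
        ?_ ?_
      · linarith
      · rw [e₁, e₂]
        linarith [hcon a haH u]
      · linarith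
      · linarith)
  exact hxy (mul_left_cancel (mul_right_cancel e))

end IsGromovHyperbolicDist

/-! ### Quasi-axes: fellow-travelling and commensuration -/

namespace IsGromovHyperbolicDist

variable {G : Type*} [Group G] {d : G → G → ℝ} {δ : ℝ}

/-- A point which is almost between the ends of a coarse quasi-geodesic is close to it. -/
theorem exists_near_quasiLine (h : IsGromovHyperbolicDist d δ) {y : ℕ → G} {n : ℕ} {L C C' : ℝ}
    (hL : 0 ≤ L) (hC : 0 ≤ C) (hC' : 0 ≤ C') (hstep : ∀ m, d (y m) (y (m + 1)) ≤ L)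
    (hy : ∀ m ≤ n, d (y 0) (y m) + d (y m) (y n) ≤ d (y 0) (y n) + C) {x : G}
    (hx : d (y 0) x + d x (y n) ≤ d (y 0) (y n) + C') :
    ∃ m ≤ n, d x (y m) ≤ L + C + C' + 2 * δ := by
  classical
  have hδ := h.delta_nonneg
  rcases lt_or_ge (d (y 0) (y n)) (d (y 0) x) with hn | hn
  · exact ⟨n, le_rfl, by linarith⟩
  -- The first such `m` overshoots by less than `L`, so `y m` and `x` are almost equally far from `y
  -- 0`.
  have hex : ∃ m, d (y 0) x ≤ d (y 0) (y m) := ⟨n, hn⟩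
  have hmin := fun m => Nat.find_min hex (m := m)
  have hspec := Nat.find_spec hex
  have hle : Nat.find hex ≤ n := Nat.find_min' hex hn
  generalize Nat.find hex = m at hmin hspec hle
  refine ⟨m, hle, ?_⟩
  rcases m with - | k
  · rw [h.self] at hspec
    rw [h.comm]
    linarith
  · have h₁ := not_le.1 (hmin k k.lt_succ_self)
    have h₂ := h.triangle (y 0) (y k) (y (k + 1))
    have h₃ := hy _ hle
    have h₄ := hstep k
    have h₅ := h.nonneg x (y n)
    have f := h.four_point x (y 0) (y (k + 1)) (y n)
    rw [h.comm x (y 0)] at f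
    rcases f with f | f <;> linarith

theorem length_zpow_natAbs (h : IsGromovHyperbolicDist d δ) (g : G) (k : ℤ) :
    d 1 (g ^ k) = d 1 (g ^ k.natAbs) := by
  rcases Int.natAbs_eq k with hk | hk
  · conv_lhs => rw [hk, zpow_natCast]
  · conv_lhs => rw [hk, zpow_neg, zpow_natCast, h.length_inv]

theorem dist_pow_pow (h : IsGromovHyperbolicDist d δ) (g : G) {i j : ℕ} (hij : i ≤ j) :
    d (g ^ i) (g ^ j) = d 1 (g ^ (j - i)) := by
  obtain ⟨k, rfl⟩ := Nat.exists_eq_add_of_le hij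
  rw [h.eq_length, pow_add]
  simp

/-- If the positive half-orbits of two quasi-axes have unbounded Gromov products, then the two
elements have a common power. -/
theorem exists_zpow_eq_zpow (h : IsGromovHyperbolicDist d δ) {a b : G} (ha : IsQuasiAdditive d a)
    (hb : IsQuasiAdditive d b) (ha' : ¬ IsOfFinOrder a)
    (hab : ∀ B : ℝ, ∃ i j : ℕ, B < d 1 (a ^ i) + d 1 (b ^ j) - d (a ^ i) (b ^ j)) :
    ∃ p q : ℤ, p ≠ 0 ∧ q ≠ 0 ∧ a ^ p = b ^ q := by
  obtain ⟨C, hC, ha⟩ := ha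
  obtain ⟨D, hD, hb⟩ := hb
  have hδ := h.delta_nonneg
  have hK := h.finite_ball (d 1 b + D + (C + 2 * δ) + 2 * δ)
  set N := hK.toFinset.card + 1 with hN
  obtain ⟨R, hR⟩ := ((Finset.range N).finite_toSet.image fun i => d 1 (a ^ i)).bddAbove
  have hR' : ∀ i < N, d 1 (a ^ i) ≤ R := fun i hi => hR ⟨i, by simpa using hi, rfl⟩
  -- A product this large forces the first `N` powers of `a` to lie almost between `1` and `b ^ j`,
  -- hence near powers of `b`, with a bound independent of `N`. Pigeonhole on the differences
  -- follows.
  obtain ⟨i, j, hij⟩ := hab (2 * R + 2 * δ)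
  have key : ∀ k < N, ∃ m : ℕ, d (a ^ k) (b ^ m) ≤ d 1 b + D + (C + 2 * δ) + 2 * δ := by
    intro k hk
    have hkR := hR' k hk
    have hki : k ≤ i := by
      by_contra! hlt
      have := hR' i (hlt.trans hk)
      linarith [h.triangle 1 (a ^ i) (b ^ j)]
    have h₁ := ha k (i - k)
    rw [Nat.add_sub_cancel' hki] at h₁
    have h₂ := h.dist_pow_pow a hki
    have hx : d (b ^ 0) (a ^ k) + d (a ^ k) (b ^ j) ≤ d (b ^ 0) (b ^ j) + (C + 2 * δ) := by
      rw [pow_zero]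
      have f := h.four_point 1 (a ^ k) (a ^ i) (b ^ j)
      rcases f with f | f
      · linarith [h.triangle 1 (a ^ k) (b ^ j)]
      · linarith
    obtain ⟨m, -, hm⟩ := h.exists_near_quasiLine (y := fun m => b ^ m) (n := j) (h.nonneg 1 b) hD
      (by linarith) (fun m => by rw [h.dist_pow_pow b m.le_succ]; simp) (fun m hm => by
        have := hb m (j - m)
        rw [Nat.add_sub_cancel' hm] at this
        rw [h.dist_pow_pow b hm, pow_zero]
        exact this) hx
    exact ⟨m, hm⟩
  choose! m hm using key
  obtain ⟨x, hx, y, hy, hxy, e⟩ := Finset.exists_ne_map_eq_of_card_lt_of_maps_to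
    (s := Finset.range N) (t := hK.toFinset) (f := fun k => (a ^ k)⁻¹ * b ^ m k) (by simp [hN]) (by
      intro k hk
      rw [Finset.mem_coe, Set.Finite.mem_toFinset, Set.mem_ofPred_eq, ← h.eq_length]
      exact hm k (by simpa using hk))
  have e' : a ^ ((x : ℤ) - y) = b ^ ((m x : ℤ) - m y) := by
    have e₁ : b ^ m x = a ^ x * ((a ^ y)⁻¹ * b ^ m y) := by
      rw [← e]; simp
    rw [zpow_sub, zpow_sub, zpow_natCast, zpow_natCast, zpow_natCast, zpow_natCast, e₁]
    group
  have hne : (x : ℤ) - y ≠ 0 := sub_ne_zero.2 (by exact_mod_cast hxy)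
  refine ⟨_, _, hne, fun h0 => hne ?_, e'⟩
  rw [h0, zpow_zero] at e'
  exact injective_zpow_iff_not_isOfFinOrder.2 ha' (e'.trans (zpow_zero a).symm)

/-- The elements which commensurate a quasi-axis stay within bounded distance of it. -/
theorem exists_near_zpow (h : IsGromovHyperbolicDist d δ) {g : G} (hg : IsQuasiAdditive d g)
    (hg' : ¬ IsOfFinOrder g) : ∃ K : ℝ, ∀ (x : G) (p q : ℤ), p ≠ 0 → x * g ^ q = g ^ p * x →
      ∃ m : ℤ, d x (g ^ m) ≤ K := by
  obtain ⟨C, hC, hg⟩ := hg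
  have hδ := h.delta_nonneg
  refine ⟨d 1 g + C + (C + 4 * δ) + 2 * δ, ?_⟩
  have main : ∀ (x : G) (p : ℕ) (q : ℤ), p ≠ 0 → x * g ^ q = g ^ (p : ℤ) * x →
      ∃ m : ℤ, d x (g ^ m) ≤ d 1 g + C + (C + 4 * δ) + 2 * δ := by
    intro x p q hp hpq
    have hgp : ¬ IsOfFinOrder (g ^ p) := fun hf => hg' (hf.of_pow hp)
    -- With `N` this large, `x` is almost midway between `g ^ (-N) * x` and `g ^ N * x`, both on its
    -- own translate of the axis. The four-point inequality moves these ends to `g ^ (-N)` and `g ^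
    -- N` with an error independent of `x`.
    obtain ⟨n, hn⟩ := (h.eventually_lt_length_pow hgp (3 * d 1 x + C + 4 * δ)).exists
    set N := p * n with hN
    rw [← pow_mul] at hn
    have hcomm : x * g ^ (q * n) = g ^ N * x := by
      have : SemiconjBy x (g ^ q) (g ^ (p : ℤ)) := hpq
      have := this.pow_right n
      rw [zpow_natCast, ← pow_mul, ← zpow_natCast (g ^ q), ← zpow_mul] at this
      exact this
    set M := (q * n).natAbs with hM
    set A := (g ^ N)⁻¹ with hA
    set B := g ^ N with hB
    have hA' : A * x = x * (g ^ (q * n))⁻¹ := by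
      rw [hA, inv_mul_eq_iff_eq_mul, ← mul_assoc, ← hcomm]
      simp
    have l₁ : d A (A * x) = d 1 x := by simpa using h.mul_left A 1 x
    have l₂ : d B (B * x) = d 1 x := by simpa using h.mul_left B 1 x
    have l₃ : d x (B * x) = d 1 (g ^ M) := by
      rw [← hcomm, h.eq_length, inv_mul_cancel_left, h.length_zpow_natAbs]
    have l₄ : d (A * x) x = d 1 (g ^ M) := by
      rw [hA', h.comm, h.eq_length, inv_mul_cancel_left, h.length_inv, h.length_zpow_natAbs]
    have l₅ : d (A * x) (B * x) = d 1 (g ^ (M + M)) := by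
      have e : (q * n + q * n).natAbs = M + M := by omega
      rw [hA', ← hcomm, h.mul_left, h.eq_length, inv_inv, ← zpow_add, h.length_zpow_natAbs, e]
    have l₆ : d A 1 = d 1 B := by rw [h.comm, hA, h.length_inv]
    have hMM := hg M M
    have t₁ := h.triangle 1 x B
    have t₂ := h.triangle x (B * x) B
    have t₃ := h.triangle A (A * x) x
    have t₄ := h.triangle A x 1
    have c₁ := h.comm (B * x) B
    have c₂ := h.comm x 1
    have s₁ : d A x + d x (B * x) ≤ d A (B * x) + C + 2 * δ := by
      have f := h.four_point (A * x) A (B * x) x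
      rw [h.comm (A * x) A, h.comm (B * x) x] at f
      rcases f with f | f <;> linarith [h.nonneg A x]
    have s₂ : d A x + d x B ≤ d A B + (C + 4 * δ) := by
      have f := h.four_point A B (B * x) x
      rw [h.comm (B * x) x, h.comm B x] at f
      rcases f with f | f <;> linarith [h.nonneg x (B * x), h.nonneg 1 x]
    obtain ⟨m, -, hm⟩ := h.exists_near_quasiLine (y := fun m => A * g ^ m) (n := N + N) (x := x)
      (C := C) (C' := C + 4 * δ) (h.nonneg 1 g) hC (by linarith)
      (fun m => by rw [h.mul_left, h.dist_pow_pow g m.le_succ]; simp)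
      (fun m hm => by
        have := hg m (N + N - m)
        rw [Nat.add_sub_cancel' hm] at this
        simp only [h.mul_left]
        rw [h.dist_pow_pow g hm, pow_zero]
        exact this)
      (by
        have e : A * g ^ (N + N) = B := by rw [pow_add, hA, inv_mul_cancel_left]
        simp only [pow_zero, mul_one]
        rw [e]
        exact s₂)
    refine ⟨-(N : ℤ) + m, ?_⟩
    rw [zpow_add, zpow_neg, zpow_natCast, zpow_natCast]
    exact hm
  intro x p q hp hpq
  rcases Int.natAbs_eq p with e | e
  · exact main x p.natAbs q (Int.natAbs_ne_zero.2 hp) (by rw [← e]; exact hpq)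
  · refine main x p.natAbs (-q) (Int.natAbs_ne_zero.2 hp) ?_
    have e' : (p.natAbs : ℤ) = -p := by omega
    rw [e', zpow_neg, zpow_neg, eq_inv_mul_iff_mul_eq, ← mul_assoc, ← hpq]
    simp

/-- A subgroup that stays within bounded distance of a cyclic subgroup is virtually cyclic. -/
theorem isVirtuallyCyclic_of_near_zpow (h : IsGromovHyperbolicDist d δ) {H : Subgroup G} {g : G}
    (hg : g ∈ H) {K : ℝ} (hK : ∀ x ∈ H, ∃ m : ℤ, d x (g ^ m) ≤ K) : IsVirtuallyCyclic H := by
  let c : H := ⟨g, hg⟩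
  refine ⟨Subgroup.zpowers c, ?_, inferInstance⟩
  have hfin : {y : H | d 1 (y : G) ≤ K}.Finite :=
    (h.finite_ball K).preimage Subtype.val_injective.injOn
  have := hfin.to_subtype
  have hsurj : Function.Surjective
      fun y : {y : H | d 1 (y : G) ≤ K} => (QuotientGroup.mk y.1 : H ⧸ Subgroup.zpowers c) := by
    intro x
    induction x using QuotientGroup.induction_on with
    | H x =>
      -- The inverse suits left cosets: `d x⁻¹ (g ^ m)` is the length of the representative `x * g ^
      -- m`.
      obtain ⟨m, hm⟩ := hK x⁻¹ (H.inv_mem x.2)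
      rw [h.eq_length, inv_inv] at hm
      refine ⟨⟨x * c ^ m, by simpa [c] using hm⟩, ?_⟩
      rw [QuotientGroup.eq]
      exact ⟨-m, by simp⟩
  have := Finite.of_surjective _ hsurj
  exact Subgroup.finiteIndex_of_finite_quotient

end IsGromovHyperbolicDist

/-! ### The dichotomy for two elements and the Tits alternative -/

namespace IsGromovHyperbolicDist

variable {G : Type*} [Group G] {d : G → G → ℝ} {δ : ℝ}

theorem isQuasiAdditive_of_loxodromic (h : IsGromovHyperbolicDist d δ) {a u : G}
    (ha : d 1 (u⁻¹ * a * u) + 3 * δ + 1 ≤ d 1 (u⁻¹ * a * u * (u⁻¹ * a * u))) :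
    IsQuasiAdditive d a ∧ ¬ IsOfFinOrder a := by
  obtain ⟨h₁, h₂⟩ := h.isQuasiAdditive_of_length_mul_self ha
  refine ⟨h.isQuasiAdditive_conj u h₁, fun hfin => h₂ ?_⟩
  have := (MulAut.conj u⁻¹).toMonoidHom.isOfFinOrder hfin
  simpa using this

theorem exists_isQuasiAdditive_pow (h : IsGromovHyperbolicDist d δ) {g : G}
    (hg : ¬ IsOfFinOrder g) : ∃ m : ℕ, 0 < m ∧ IsQuasiAdditive d (g ^ m) := by
  have hinf : (Subgroup.zpowers g : Set G).Infinite := infinite_zpowers.2 hg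
  obtain ⟨a, ⟨k, rfl⟩, u, hu⟩ := h.exists_loxodromic _ hinf
  obtain ⟨h₁, h₂⟩ := h.isQuasiAdditive_of_loxodromic hu
  simp only at h₁ h₂
  have hk : k ≠ 0 := by
    rintro rfl
    exact h₂ (by simp)
  refine ⟨k.natAbs, Int.natAbs_pos.2 hk, ?_⟩
  rcases Int.natAbs_eq k with e | e
  · rwa [e, zpow_natCast] at h₁
  · rw [e, zpow_neg, zpow_natCast] at h₁
    simpa using h.isQuasiAdditive_inv h₁

/-- Two elements of infinite order have a common power, or suitable powers of them generate a free
group of rank two. -/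
theorem zpow_eq_zpow_or_isFreeOfRankTwo (h : IsGromovHyperbolicDist d δ) {g₁ g₂ : G}
    (hg₁ : ¬ IsOfFinOrder g₁) (hg₂ : ¬ IsOfFinOrder g₂) :
    (∃ p q : ℤ, p ≠ 0 ∧ q ≠ 0 ∧ g₁ ^ p = g₂ ^ q) ∨
      ∃ k : ℕ, 0 < k ∧ IsFreeOfRankTwo (Subgroup.closure {g₁ ^ k, g₂ ^ k}) := by
  obtain ⟨m₁, hm₁, hq₁⟩ := h.exists_isQuasiAdditive_pow hg₁
  obtain ⟨m₂, hm₂, hq₂⟩ := h.exists_isQuasiAdditive_pow hg₂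
  set k := m₁ * m₂ with hk
  have hk₀ : 0 < k := Nat.mul_pos hm₁ hm₂
  have ha : IsQuasiAdditive d (g₁ ^ k) := by
    rw [hk, pow_mul]; exact hq₁.pow m₂
  have hb : IsQuasiAdditive d (g₂ ^ k) := by
    rw [hk, mul_comm, pow_mul]; exact hq₂.pow m₁
  have ha' : ¬ IsOfFinOrder (g₁ ^ k) := fun hf => hg₁ (hf.of_pow hk₀.ne')
  have hb' : ¬ IsOfFinOrder (g₂ ^ k) := fun hf => hg₂ (hf.of_pow hk₀.ne')
  set a := g₁ ^ k with hadef
  set b := g₂ ^ k with hbdef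
  rw [or_iff_not_imp_left]
  intro hno
  have hbound : ∀ x y : G, (x = a ∨ x = a⁻¹) → (y = b ∨ y = b⁻¹) →
      ∃ B : ℝ, ∀ i j : ℕ, d 1 (x ^ i) + d 1 (y ^ j) - d (x ^ i) (y ^ j) ≤ B := by
    intro x y hx hy
    by_contra! hcon
    have hx₁ : IsQuasiAdditive d x := by
      rcases hx with rfl | rfl
      exacts [ha, h.isQuasiAdditive_inv ha]
    have hy₁ : IsQuasiAdditive d y := by
      rcases hy with rfl | rfl
      exacts [hb, h.isQuasiAdditive_inv hb]
    have hx₂ : ¬ IsOfFinOrder x := by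
      rcases hx with rfl | rfl
      exacts [ha', fun hf => ha' (isOfFinOrder_inv_iff.1 hf)]
    obtain ⟨p, q, hp, hq, e⟩ := h.exists_zpow_eq_zpow hx₁ hy₁ hx₂ hcon
    have hkz : (k : ℤ) ≠ 0 := by exact_mod_cast hk₀.ne'
    have hx₃ : ∃ p' : ℤ, p' ≠ 0 ∧ g₁ ^ p' = x ^ p := by
      rcases hx with rfl | rfl
      · exact ⟨k * p, mul_ne_zero hkz hp, by rw [zpow_mul, zpow_natCast]⟩
      · exact ⟨k * -p, mul_ne_zero hkz (neg_ne_zero.2 hp), by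
          rw [zpow_mul, zpow_natCast, inv_zpow, zpow_neg]⟩
    have hy₃ : ∃ q' : ℤ, q' ≠ 0 ∧ g₂ ^ q' = y ^ q := by
      rcases hy with rfl | rfl
      · exact ⟨k * q, mul_ne_zero hkz hq, by rw [zpow_mul, zpow_natCast]⟩
      · exact ⟨k * -q, mul_ne_zero hkz (neg_ne_zero.2 hq), by
          rw [zpow_mul, zpow_natCast, inv_zpow, zpow_neg]⟩
    obtain ⟨p', hp', ep⟩ := hx₃
    obtain ⟨q', hq', eq⟩ := hy₃
    exact hno ⟨p', q', hp', hq', by rw [ep, eq, e]⟩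
  obtain ⟨B₁, hB₁⟩ := hbound a b (Or.inl rfl) (Or.inl rfl)
  obtain ⟨B₂, hB₂⟩ := hbound a b⁻¹ (Or.inl rfl) (Or.inr rfl)
  obtain ⟨B₃, hB₃⟩ := hbound a⁻¹ b (Or.inr rfl) (Or.inl rfl)
  obtain ⟨B₄, hB₄⟩ := hbound a⁻¹ b⁻¹ (Or.inr rfl) (Or.inr rfl)
  -- The length of `x * y` is `d x⁻¹ y`, so a bounded Gromov product loses at most a constant;
  -- quasi-additivity does the same for squares. `M` exceeds each loss by at least `2δ + 1`.
  obtain ⟨C, hC, hqa⟩ := ha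
  obtain ⟨D, hD, hqb⟩ := hb
  set M := |B₁| + |B₂| + |B₃| + |B₄| + C + D + 2 * δ + 1 with hM
  obtain ⟨n, ⟨hna, hnb⟩, hn⟩ := ((h.eventually_lt_length_pow ha' M).and
    (h.eventually_lt_length_pow hb' M)).and (Filter.eventually_gt_atTop 0) |>.exists
  have a₁ := abs_nonneg B₁
  have a₂ := abs_nonneg B₂
  have a₃ := abs_nonneg B₃
  have a₄ := abs_nonneg B₄
  have b₁ := le_abs_self B₁
  have b₂ := le_abs_self B₂
  have b₃ := le_abs_self B₃
  have b₄ := le_abs_self B₄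
  refine ⟨k * n, Nat.mul_pos hk₀ hn, ?_⟩
  rw [pow_mul g₁ k n, pow_mul g₂ k n, ← hadef, ← hbdef]
  refine h.isFreeOfRankTwo_closure _ _ ?_ ?_ ?_
  · have := hqa n n
    rw [pow_add] at this
    linarith
  · have := hqb n n
    rw [pow_add] at this
    linarith
  · have c₁ := hB₁ n n
    have c₂ := hB₂ n n
    have c₃ := hB₃ n n
    have c₄ := hB₄ n n
    rw [h.eq_length (_ ^ n) (_ ^ n)] at c₁ c₂ c₃ c₄
    simp only [inv_pow, inv_inv, h.length_inv] at c₁ c₂ c₃ c₄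
    rintro x y (rfl | rfl) (rfl | rfl) <;> constructor <;> linarith

/-- Commensuration passes to a power of `g` with a quasi-axis, and `exists_near_zpow` bounds the
distance to it uniformly over `H`. -/
theorem isVirtuallyCyclic_of_commensurates (h : IsGromovHyperbolicDist d δ) {H : Subgroup G} {g : G}
    (hgH : g ∈ H) (hg : ¬ IsOfFinOrder g)
    (hH : ∀ x ∈ H, ∃ p q : ℤ, p ≠ 0 ∧ x * g ^ q = g ^ p * x) : IsVirtuallyCyclic H := by
  obtain ⟨m, hm, hq⟩ := h.exists_isQuasiAdditive_pow hg
  obtain ⟨K, hK⟩ := h.exists_near_zpow hq fun hf => hg (hf.of_pow hm.ne')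
  refine h.isVirtuallyCyclic_of_near_zpow (H.pow_mem hgH m) (K := K) fun x hx => ?_
  obtain ⟨p, q, hp, e⟩ := hH x hx
  refine hK x p q hp ?_
  have := (show SemiconjBy x (g ^ q) (g ^ p) from e).pow_right m
  rw [← zpow_natCast g m, ← zpow_mul, ← zpow_mul, mul_comm (m : ℤ) q, mul_comm (m : ℤ) p, zpow_mul,
    zpow_mul, zpow_natCast, zpow_natCast]
  exact this

theorem isVirtuallyCyclic_closure_pair (h : IsGromovHyperbolicDist d δ) {g₁ g₂ : G} {p q : ℤ}
    (hg : ¬ IsOfFinOrder g₁) (hp : p ≠ 0) (e : g₁ ^ p = g₂ ^ q) :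
    IsVirtuallyCyclic (Subgroup.closure {g₁, g₂}) := by
  refine h.isVirtuallyCyclic_of_commensurates (Subgroup.subset_closure (by simp)) hg
    fun x hx => ⟨p, p, hp, ?_⟩
  have hle : Subgroup.closure {g₁, g₂} ≤ Subgroup.centralizer {g₁ ^ p} := by
    rw [Subgroup.closure_le]
    rintro y (rfl | rfl) <;> refine Subgroup.mem_centralizer_singleton_iff.2 ?_
    · exact Commute.self_zpow y p
    · rw [e]
      exact Commute.self_zpow y q
  exact Subgroup.mem_centralizer_singleton_iff.1 (hle hx)

/-- The Tits alternative. -/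
theorem exists_isFreeOfRankTwo_or_isVirtuallyCyclic (h : IsGromovHyperbolicDist d δ)
    (H : Subgroup G) : (∃ F : Subgroup G, F ≤ H ∧ IsFreeOfRankTwo F) ∨ IsVirtuallyCyclic H := by
  rcases (H : Set G).finite_or_infinite with hfin | hinf
  · right
    have : Finite H := hfin.to_subtype
    exact ⟨⊥, inferInstance, inferInstance⟩
  obtain ⟨a, ha, u, hu⟩ := h.exists_loxodromic H hinf
  have hinfo := (h.isQuasiAdditive_of_loxodromic hu).2
  rw [or_iff_not_imp_left]
  intro hno
  refine h.isVirtuallyCyclic_of_commensurates ha hinfo fun x hx => ?_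
  -- A common power of `a` and this conjugate is exactly a commensuration relation for `x`.
  have hconj : x * a * x⁻¹ ∈ H := H.mul_mem (H.mul_mem hx ha) (H.inv_mem hx)
  have hinfo' : ¬ IsOfFinOrder (x * a * x⁻¹) := fun hf => hinfo
    ((Function.Injective.isOfFinOrder_iff (f := (MulAut.conj x).toMonoidHom)
      (MulAut.conj x).injective).1 hf)
  rcases h.zpow_eq_zpow_or_isFreeOfRankTwo hinfo hinfo' with ⟨p, q, hp, -, e⟩ | ⟨k, -, hfree⟩
  · refine ⟨p, q, hp, ?_⟩
    rw [e, conj_zpow]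
    simp
  · refine absurd ⟨_, ?_, hfree⟩ hno
    rw [Subgroup.closure_le]
    rintro y (rfl | rfl)
    exacts [H.pow_mem ha k, H.pow_mem hconj k]

end IsGromovHyperbolicDist

theorem mainTheorem8 {G : Type*} [Group G] (hG : IsHyperbolicGroup G) :
    (∀ g₁ g₂ : G, ¬ IsOfFinOrder g₁ → ¬ IsOfFinOrder g₂ →
      IsVirtuallyCyclic (Subgroup.closure {g₁, g₂}) ∨
        ∃ k : ℕ, 0 < k ∧ IsFreeOfRankTwo (Subgroup.closure {g₁ ^ k, g₂ ^ k})) ∧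
    (∀ H : Subgroup G,
      (∃ F : Subgroup G, F ≤ H ∧ IsFreeOfRankTwo F) ∨ IsVirtuallyCyclic H) := by
  obtain ⟨d, δ, h⟩ := hG.exists_isGromovHyperbolicDist
  refine ⟨fun g₁ g₂ hg₁ hg₂ => ?_, h.exists_isFreeOfRankTwo_or_isVirtuallyCyclic⟩
  rcases h.zpow_eq_zpow_or_isFreeOfRankTwo hg₁ hg₂ with ⟨p, q, hp, -, e⟩ | hfree
  · exact Or.inl (h.isVirtuallyCyclic_closure_pair hg₁ hp e)
  · exact Or.inr hfree
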